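/- Let $\mathbb T=\mathbb R/2\pi\mathbb Z$, let $\mu$ be the probability measure $d\mu=\frac{1}{2\pi}dx$ on $\mathbb T$, and for a measurable set $Y\subset\mathbb T$ let $\pi_Y$ be the operator $\pi_Yf=1_Y f$ on $L^2(\mathbb T,\mu)$. A finite measurable partition of $\mathbb T$ is a finite family $\chi=\{Y_1,\dots,Y_J\}$ of measurable sets with $\mu\bigl(\mathbb T\setminus\bigcup_jY_j\bigr)=0$ and $\mu(Y_j\cap Y_k)=0$ for $j\ne k$. For a bounded operator $W$ on $L^2(\mathbb T,\mu)$ put $$\|W\|_\mu=\inf_\chi\Bigl(\sum_{j=1}^J\mu(Y_j)\,\|W\pi_{Y_j}\|^2\Bigr)^{1/2},$$ where the infimum is over all finite measurable partitions $\chi$ and $\|\cdot\|$ is the operator norm. For $j,k\in\mathbb Z$ let $W_{j,k}$ be the $j$-th Fourier coefficient of $W e^{ikx}$, so that $W$ maps $\sum_k f_ke^{ikx}$ to $\sum_{j}\bigl(\sum_k W_{j,k}f_k\bigr)e^{ijx}$. Suppose that $W$ is of diagonal type, i.e. there is a sequence $(c_s)_{s\in\mathbb Z}$ of real numbers with $\sum_s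 c_s<\infty$ and $|W_{j,k}|\le c_{j-k}$ for all $j,k\in\mathbb Z$. For $a\in\mathbb T$ put $$w_l(a)=\sum_{j\in\mathbb Z}W_{l,j}\,e^{i(l-j)a}\quad(l\in\mathbb Z),\qquad \rho(L_a)=\limsup_{\#I\to\infty}\frac1{\#I}\sum_{l\in I}|w_l(a)|^2,$$ where $I$ ranges over the finite integer intervals $\{m,m+1,\dots,n\}\subset\mathbb Z$ (so $w_l(a)$ are the Fourier coefficients of the distribution $L_a=\sum_l w_l(a)e^{ilx}$). Then $a\mapsto\rho(L_a)$ is integrable on $\mathbb T$ and $$\|W\|_\mu^2=\frac1{2\pi}\int_{\mathbb T}\rho(L_a)\,da .$$ -/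

import Mathlib

open MeasureTheory Filter AddCircle
open scoped ENNReal Real

noncomputable section

namespace MuNorm

section General

variable {X : Type*} [MeasurableSpace X] (μ : Measure X)

/-- The function `1_Y · f` as an element of `L²(X, μ)`. -/
def indicatorLp (Y : Set X) (hY : MeasurableSet Y) (f : Lp ℂ 2 μ) : Lp ℂ 2 μ :=
  MemLp.toLp (Y.indicator (f : X → ℂ)) ((Lp.memLp f).indicator hY)

theorem coeFn_indicatorLp (Y : Set X) (hY : MeasurableSet Y) (f : Lp ℂ 2 μ) :
    (indicatorLp μ Y hY f : X → ℂ) =ᵐ[μ] Y.indicator (f : X → ℂ) := by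
  unfold indicatorLp
  exact MemLp.coeFn_toLp _

theorem indicatorLp_add (Y : Set X) (hY : MeasurableSet Y) (f g : Lp ℂ 2 μ) :
    indicatorLp μ Y hY (f + g) = indicatorLp μ Y hY f + indicatorLp μ Y hY g := by
  refine Lp.ext ?_
  filter_upwards [coeFn_indicatorLp μ Y hY (f + g), coeFn_indicatorLp μ Y hY f,
    coeFn_indicatorLp μ Y hY g, Lp.coeFn_add f g,
    Lp.coeFn_add (indicatorLp μ Y hY f) (indicatorLp μ Y hY g)] with x h1 h2 h3 h4 h5
  rw [h1, h5, Pi.add_apply, h2, h3]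
  by_cases h : x ∈ Y
  · rw [Set.indicator_of_mem h, Set.indicator_of_mem h, Set.indicator_of_mem h, h4, Pi.add_apply]
  · rw [Set.indicator_of_notMem h, Set.indicator_of_notMem h, Set.indicator_of_notMem h, add_zero]

theorem indicatorLp_smul (Y : Set X) (hY : MeasurableSet Y) (c : ℂ) (f : Lp ℂ 2 μ) :
    indicatorLp μ Y hY (c • f) = c • indicatorLp μ Y hY f := by
  refine Lp.ext ?_
  filter_upwards [coeFn_indicatorLp μ Y hY (c • f), coeFn_indicatorLp μ Y hY f,
    Lp.coeFn_smul c f, Lp.coeFn_smul c (indicatorLp μ Y hY f)] with x h1 h2 h3 h4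
  rw [h1, h4, Pi.smul_apply, h2]
  by_cases h : x ∈ Y
  · rw [Set.indicator_of_mem h, Set.indicator_of_mem h, h3, Pi.smul_apply]
  · rw [Set.indicator_of_notMem h, Set.indicator_of_notMem h, smul_zero]

theorem norm_indicatorLp_le (Y : Set X) (hY : MeasurableSet Y) (f : Lp ℂ 2 μ) :
    ‖indicatorLp μ Y hY f‖ ≤ 1 * ‖f‖ := by
  rw [one_mul]
  refine Lp.norm_le_norm_of_ae_le ?_
  filter_upwards [coeFn_indicatorLp μ Y hY f] with x hx
  rw [hx]
  exact norm_indicator_le_norm_self _ _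

/-- The orthogonal projector `π_Y f = 1_Y · f` on `L²(X, μ)`, for a measurable set `Y`. -/
def proj (Y : Set X) (hY : MeasurableSet Y) : Lp ℂ 2 μ →L[ℂ] Lp ℂ 2 μ :=
  LinearMap.mkContinuous
    { toFun := indicatorLp μ Y hY
      map_add' := indicatorLp_add μ Y hY
      map_smul' := indicatorLp_smul μ Y hY }
    1 (norm_indicatorLp_le μ Y hY)

/-- A finite measurable partition `{Y_1, …, Y_J}` of `X`, up to sets of measure zero. -/
structure FinitePartition where
  size : ℕ
  cell : Fin size → Set X
  measurableSet_cell : ∀ j, MeasurableSet (cell j)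
  measure_compl_iUnion : μ (⋃ j, cell j)ᶜ = 0
  measure_inter : ∀ j k, j ≠ k → μ (cell j ∩ cell k) = 0

variable {μ}

/-- `M_χ(W) = ∑_j μ(Y_j) ‖W π_{Y_j}‖²` for the partition `χ = {Y_1, …, Y_J}`. -/
def partitionSum (W : Lp ℂ 2 μ →L[ℂ] Lp ℂ 2 μ) (χ : FinitePartition μ) : ℝ :=
  ∑ j, μ.real (χ.cell j) * ‖W ∘L proj μ (χ.cell j) (χ.measurableSet_cell j)‖ ^ 2

/-- The `μ`-norm `‖W‖_μ = inf_χ √(M_χ(W))`, over all finite measurable partitions `χ`. -/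
def muNorm (W : Lp ℂ 2 μ →L[ℂ] Lp ℂ 2 μ) : ℝ :=
  ⨅ χ : FinitePartition μ, √(partitionSum W χ)

end General

section Circle

instance fact_two_pi_pos : Fact (0 < 2 * π) := ⟨Real.two_pi_pos⟩

/-- The circle `ℝ / 2πℤ`. -/
abbrev Circle2Pi : Type := AddCircle (2 * π)

/-- `L²` of the circle for the normalized measure `dx / 2π`. -/
abbrev L2 : Type := Lp ℂ 2 (haarAddCircle : Measure Circle2Pi)

/-- The matrix entry `W_{j,k}`: the `j`-th Fourier coefficient of `W e^{ikx}`. -/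
def entry (W : L2 →L[ℂ] L2) (j k : ℤ) : ℂ :=
  fourierCoeff (W (fourierLp 2 k) : Circle2Pi → ℂ) j

/-- `W` is of diagonal type: `|W_{j,k}| ≤ c_{j-k}` for a summable sequence `c`. -/
def IsDiagonalType (W : L2 →L[ℂ] L2) : Prop :=
  ∃ c : ℤ → ℝ, Summable c ∧ ∀ j k, ‖entry W j k‖ ≤ c (j - k)

/-- The Fourier coefficients `w_l(a) = ∑_j W_{l,j} e^{i(l-j)a}` of the distribution `L_a`. -/
def coeffL (W : L2 →L[ℂ] L2) (a : Circle2Pi) (l : ℤ) : ℂ :=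
  ∑' j : ℤ, entry W l j * fourier (l - j) a

/-- `ρ(lam) = limsup_{#I → ∞} (1/#I) ∑_{k ∈ I} |lam_k|²` over integer intervals
`I = {m, …, n}`, for a distribution with (bounded) Fourier coefficients `lam`. -/
def rho (lam : ℤ → ℂ) : ℝ :=
  limsup (fun I : ℤ × ℤ =>
      (∑ k ∈ Finset.Icc I.1 I.2, ‖lam k‖ ^ 2) / ((Finset.Icc I.1 I.2).card : ℝ))
    (comap (fun I : ℤ × ℤ => (Finset.Icc I.1 I.2).card) atTop)

end Circle

end MuNorm

end

/-! Write `e_s` for `fourier s`. In coordinates, `W f` is the sum over `s` of the `s`-th diagonal of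
`W` applied to `e_s f`. Near a point `a`, multiplication by `e_s` is almost the scalar `e_s(a)`, so
on functions living near `a` the operator is almost the Fourier multiplier with symbol `w_l(a)`. The
theorem says that the squared norm of this local multiplier is the sliding mean `ρ(L_a)`.

Upper bound (`exists_open_norm_apply_le`): if `f` lives near `a`, replacing `f` by `e_r f` for `r <
N` changes it only by a phase and a small error. Averaging the multiplier norm over these shifts
replaces `|w_l|²` by its means over windows of length `N`, which are at most `ρ(L_a)` plus a small
error. Since `ρ(L_a)` is continuous in `a`, compactness of the circle gives a partition whose sum is
close to the integral.

Lower bound (`setIntegral_rho_coeffL_le`): on each cell `Y`, the integral of `ρ(L_a)` is at most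
`μ(Y) ‖W π_Y‖²`. Test `W` on a block of `N` exponentials centred at `a`. Inside the block the
coefficients of the image are `w_l(a)` up to phase and boundary terms, so the window sums of
`|w_l(a)|²` are controlled by the norm of the image. The part of the test function outside `Y` has
squared norm `N` times the Fejér mean of `1_Yᶜ` at `a`. The integral of that mean over `Y` tends to
zero by Parseval, because `1_Y` and `1_Yᶜ` are orthogonal. -/

namespace MuNorm

/-! ### The limsup `ρ` and uniform window means -/

section Rho

/-- The filter `#I → ∞` on integer intervals `I = {m, …, n}`. -/
noncomputable abbrev longIntervals : Filter (ℤ × ℤ) :=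
  comap (fun I : ℤ × ℤ => (Finset.Icc I.1 I.2).card) atTop

/-- The mean of `|lam_k|²` over `{m, …, n}`. -/
noncomputable abbrev intervalMean (lam : ℤ → ℂ) (I : ℤ × ℤ) : ℝ :=
  (∑ k ∈ Finset.Icc I.1 I.2, ‖lam k‖ ^ 2) / ((Finset.Icc I.1 I.2).card : ℝ)

instance longIntervals_neBot : NeBot longIntervals := by
  refine comap_neBot_iff.2 fun t ht => ?_
  obtain ⟨n, hn⟩ := mem_atTop_sets.1 ht
  exact ⟨(1, n), hn _ (by simp)⟩

theorem intervalMean_nonneg (lam : ℤ → ℂ) (I : ℤ × ℤ) : 0 ≤ intervalMean lam I := by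
  unfold intervalMean; positivity

theorem intervalMean_le {lam : ℤ → ℂ} {C : ℝ} (hC : ∀ k, ‖lam k‖ ≤ C) (I : ℤ × ℤ) :
    intervalMean lam I ≤ C ^ 2 := by
  -- This form of the division lemma also covers the empty interval, whose mean is `0 / 0 = 0`.
  refine div_le_of_le_mul₀ (by positivity) (by positivity) ?_
  calc _ ≤ ∑ k ∈ Finset.Icc I.1 I.2, C ^ 2 :=
        Finset.sum_le_sum fun k _ => pow_le_pow_left₀ (norm_nonneg _) (hC k) 2
    _ = _ := by rw [Finset.sum_const, nsmul_eq_mul, mul_comm]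

theorem isBoundedUnder_intervalMean {lam : ℤ → ℂ} {C : ℝ} (hC : ∀ k, ‖lam k‖ ≤ C) :
    IsBoundedUnder (· ≤ ·) longIntervals (intervalMean lam) :=
  isBoundedUnder_of ⟨C ^ 2, intervalMean_le hC⟩

theorem isCoboundedUnder_intervalMean (lam : ℤ → ℂ) :
    IsCoboundedUnder (· ≤ ·) longIntervals (intervalMean lam) :=
  (isBoundedUnder_of ⟨0, fun I => intervalMean_nonneg lam I⟩ :
    IsBoundedUnder (· ≥ ·) longIntervals (intervalMean lam)).isCoboundedUnder_le

theorem rho_le_of_eventually {lam : ℤ → ℂ} {R : ℝ}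
    (h : ∀ᶠ I in longIntervals, intervalMean lam I ≤ R) : rho lam ≤ R :=
  limsup_le_of_le (isCoboundedUnder_intervalMean lam) h

theorem rho_nonneg {lam : ℤ → ℂ} {C : ℝ} (hC : ∀ k, ‖lam k‖ ≤ C) : 0 ≤ rho lam :=
  le_limsup_of_frequently_le (Frequently.of_forall (intervalMean_nonneg lam))
    (isBoundedUnder_intervalMean hC)

theorem tendsto_card_longIntervals :
    Tendsto (fun I : ℤ × ℤ => ((Finset.Icc I.1 I.2).card : ℝ)) longIntervals atTop :=
  tendsto_natCast_atTop_atTop.comp tendsto_comap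

theorem sum_Icc_eq_sum_range (x : ℤ → ℝ) (m : ℤ) (N : ℕ) :
    ∑ k ∈ Finset.Icc m (m + N - 1), x k = ∑ r ∈ Finset.range N, x (m + r) := by
  symm
  refine Finset.sum_bij (fun r _ => m + (r : ℤ)) ?_ ?_ ?_ ?_
  · intro r hr
    have := Finset.mem_range.1 hr
    rw [Finset.mem_Icc]; omega
  · intro r _ q _ h; omega
  · intro k hk
    have := Finset.mem_Icc.1 hk
    exact ⟨(k - m).toNat, by rw [Finset.mem_range]; omega, by omega⟩
  · intros; rfl

theorem sum_range_mul_le {x : ℤ → ℝ} {N : ℕ} {R : ℝ}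
    (h : ∀ m : ℤ, ∑ r ∈ Finset.range N, x (m + r) ≤ N * R) (m : ℤ) (k : ℕ) :
    ∑ r ∈ Finset.range (k * N), x (m + r) ≤ (k * N : ℕ) * R := by
  induction k with
  | zero => simp
  | succ k ih =>
    rw [Nat.succ_mul, Finset.sum_range_add]
    have := h (m + (k * N : ℕ))
    simp only [Nat.cast_add, ← add_assoc]
    push_cast at *
    linarith

/-- An interval of `n` points is covered by `n / N + 1` blocks of length `N`, overshooting by at
most `N` points, which is negligible for large `n`. With the converse `exists_sum_range_le`, this
trades the limsup for a bound on windows of one fixed length, uniform in their position. -/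
theorem rho_le_of_sum_range_le {lam : ℤ → ℂ} {N : ℕ} (hN : 0 < N) {R : ℝ} (hR : 0 ≤ R)
    (h : ∀ m : ℤ, ∑ r ∈ Finset.range N, ‖lam (m + r)‖ ^ 2 ≤ N * R) : rho lam ≤ R := by
  refine le_of_forall_pos_le_add fun ε hε => rho_le_of_eventually ?_
  -- Beyond this length the overshoot costs `N * R ≤ ε * n`; the `+ 1` makes the interval nonempty.
  filter_upwards [tendsto_card_longIntervals.eventually_ge_atTop (N * R / ε + 1)] with I hI
  set n := (Finset.Icc I.1 I.2).card with hn
  have hn0 : (0 : ℝ) < n := lt_of_lt_of_le (by positivity) hI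
  have hn1 : 0 < n := by exact_mod_cast hn0
  rw [Int.card_Icc] at hn
  have hsub : Finset.Icc I.1 I.2 ⊆ Finset.Icc I.1 (I.1 + ((n / N + 1) * N : ℕ) - 1) := by
    refine Finset.Icc_subset_Icc_right ?_
    have h1 : n < (n / N + 1) * N := by
      rw [Nat.add_mul, one_mul]; exact Nat.lt_div_mul_add hN
    omega
  have h2 : ∑ k ∈ Finset.Icc I.1 I.2, ‖lam k‖ ^ 2 ≤ (n + N) * R := by
    calc _ ≤ ∑ k ∈ Finset.Icc I.1 (I.1 + ((n / N + 1) * N : ℕ) - 1), ‖lam k‖ ^ 2 :=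
          Finset.sum_le_sum_of_subset_of_nonneg hsub fun _ _ _ => by positivity
      _ ≤ ((n / N + 1) * N : ℕ) * R := by
          rw [sum_Icc_eq_sum_range (fun k => ‖lam k‖ ^ 2)]
          exact sum_range_mul_le (x := fun k => ‖lam k‖ ^ 2) h _ _
      _ ≤ _ := by
          refine mul_le_mul_of_nonneg_right ?_ hR
          have : (n / N + 1) * N ≤ n + N := by
            rw [Nat.add_mul, one_mul]
            exact Nat.add_le_add_right (Nat.div_mul_le_self n N) N
          exact_mod_cast this
  rw [div_le_iff₀ (by exact_mod_cast hn1)]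
  have h3 : N * R ≤ ε * n := by
    rw [mul_comm ε, ← div_le_iff₀ hε]; linarith
  change _ ≤ (R + ε) * (n : ℝ)
  nlinarith

theorem exists_sum_range_le {lam : ℤ → ℂ} {C : ℝ} (hC : ∀ k, ‖lam k‖ ≤ C) {ε : ℝ} (hε : 0 < ε) :
    ∃ N : ℕ, 0 < N ∧ ∀ m : ℤ, ∑ r ∈ Finset.range N, ‖lam (m + r)‖ ^ 2 ≤ N * (rho lam + ε) := by
  have h : ∀ᶠ I in longIntervals, intervalMean lam I < rho lam + ε :=
    eventually_lt_of_limsup_lt (lt_add_of_pos_right _ hε) (isBoundedUnder_intervalMean hC)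
  obtain ⟨N, hN⟩ := mem_atTop_sets.1 (eventually_comap.1 h)
  refine ⟨N + 1, N.succ_pos, fun m => ?_⟩
  have h1 := hN (N + 1) (Nat.le_succ N) (m, m + (N + 1 : ℕ) - 1)
    (by simp only [Int.card_Icc]; omega)
  have h2 : (Finset.Icc m (m + (N + 1 : ℕ) - 1)).card = N + 1 := by
    simp only [Int.card_Icc]; omega
  unfold intervalMean at h1
  simp only [h2] at h1
  rw [sum_Icc_eq_sum_range (fun k => ‖lam k‖ ^ 2), div_lt_iff₀ (by positivity)] at h1
  linarith

/-- Factor the difference of squares: one factor is at most `δ`, the other at most `2 * C`. -/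
theorem rho_le_rho_add {lam lam' : ℤ → ℂ} {C δ : ℝ} (hC : ∀ k, ‖lam k‖ ≤ C)
    (hC' : ∀ k, ‖lam' k‖ ≤ C) (h : ∀ k, ‖lam k - lam' k‖ ≤ δ) :
    rho lam ≤ rho lam' + 2 * C * δ := by
  refine le_of_forall_pos_le_add fun ε hε => ?_
  obtain ⟨N, hN, hle⟩ := exists_sum_range_le hC' hε
  have hC0 : 0 ≤ C := (norm_nonneg _).trans (hC 0)
  have hδ0 : 0 ≤ δ := (norm_nonneg _).trans (h 0)
  refine rho_le_of_sum_range_le hN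
    (by have := rho_nonneg hC'; positivity) fun m => ?_
  calc _ ≤ ∑ r ∈ Finset.range N, (‖lam' (m + r)‖ ^ 2 + 2 * C * δ) := by
        refine Finset.sum_le_sum fun r _ => ?_
        have h1 := norm_le_norm_add_norm_sub' (lam (m + r)) (lam' (m + r))
        have h2 := h (m + r)
        nlinarith [hC (m + r), hC' (m + r), norm_nonneg (lam (m + r)), norm_nonneg (lam' (m + r))]
    _ ≤ _ := by
        rw [Finset.sum_add_distrib, Finset.sum_const, Finset.card_range, nsmul_eq_mul]
        linarith [hle m]

end Rho

/-! ### Terms leaving a block of length `N` -/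

section Boundary

/-- The steps `s` by which the position `r` leaves the block `{0, …, N - 1}`. -/
def exitSteps (N r : ℕ) : Set ℤ := {s | ¬ (0 ≤ (r : ℤ) - s ∧ (r : ℤ) - s < N)}

theorem tsum_eq_sum_range_add {E : Type*} [NormedAddCommGroup E] [CompleteSpace E] {p : ℤ → E}
    (hp : Summable p) (N r : ℕ) :
    ∑' s, p s = ∑ q ∈ Finset.range N, p (r - q) + ∑' s, (exitSteps N r).indicator p s := by
  have hinj : Function.Injective fun q : ℕ => (r : ℤ) - q := fun a b h => by
    simpa using h
  have h1 : ∑ q ∈ Finset.range N, p (r - q) = ∑' s, (exitSteps N r)ᶜ.indicator p s := by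
    rw [← Finset.sum_image (f := p) (g := fun q : ℕ => (r : ℤ) - q) hinj.injOn,
      tsum_eq_sum (s := (Finset.range N).image fun q : ℕ => (r : ℤ) - q)]
    · refine Finset.sum_congr rfl fun s hs => ?_
      rw [Set.indicator_of_mem]
      obtain ⟨q, hq, rfl⟩ := Finset.mem_image.1 hs
      have := Finset.mem_range.1 hq
      simp only [exitSteps, Set.mem_compl_iff, Set.mem_ofPred_eq, not_not]
      omega
    · intro s hs
      refine Set.indicator_of_notMem (fun h => hs ?_) _
      simp only [exitSteps, Set.mem_compl_iff, Set.mem_ofPred_eq, not_not] at h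
      exact Finset.mem_image.2 ⟨(r - s).toNat, by rw [Finset.mem_range]; omega, by omega⟩
  rw [h1, ← (hp.indicator _).tsum_add (hp.indicator _)]
  exact tsum_congr fun s => (Set.indicator_compl_add_self_apply _ _ _).symm

/-- A step `s > 0` leaves the block only from its first `s` positions, a step `s < 0` only from its
last `|s|`. -/
theorem sum_indicator_exitSteps_le {c : ℤ → ℝ} (h0 : ∀ s, 0 ≤ c s) (N : ℕ) (s : ℤ) :
    ∑ r ∈ Finset.range N, (exitSteps N r).indicator c s ≤ c s * min |(s : ℝ)| N := by
  classical
  have h1 : ∀ r, (exitSteps N r).indicator c s = if s ∈ exitSteps N r then c s else 0 :=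
    fun r => Set.indicator_apply _ _ _
  simp only [h1]
  rw [← Finset.sum_filter, Finset.sum_const, nsmul_eq_mul, mul_comm]
  refine mul_le_mul_of_nonneg_left (le_min ?_ ?_) (h0 s)
  · have hsub : (Finset.range N).filter (fun r => s ∈ exitSteps N r) ⊆
        Finset.range s.toNat ∪ Finset.Ico (N - (-s).toNat) N := by
      intro r hr
      rw [Finset.mem_filter, Finset.mem_range] at hr
      obtain ⟨hr, hs⟩ := hr
      simp only [exitSteps, Set.mem_ofPred_eq] at hs
      simp only [Finset.mem_union, Finset.mem_range, Finset.mem_Ico]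
      omega
    have h2 : ((Finset.range N).filter (fun r => s ∈ exitSteps N r)).card ≤ s.natAbs := by
      refine (Finset.card_le_card hsub).trans ((Finset.card_union_le _ _).trans ?_)
      simp only [Finset.card_range, Nat.card_Ico]
      omega
    calc _ ≤ ((s.natAbs : ℕ) : ℝ) := by exact_mod_cast h2
      _ = _ := by rw [Nat.cast_natAbs, Int.cast_abs]
  · exact_mod_cast (Finset.card_filter_le _ _).trans (Finset.card_range N).le

/-- The mean over a block of length `N` of the mass of `c` on the steps leaving the block,
up to an upper bound. -/
noncomputable def exitMass (c : ℤ → ℝ) (N : ℕ) : ℝ := ∑' s, c s * (min |(s : ℝ)| N / N)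

theorem exitMass_term_le {c : ℤ → ℝ} (h0 : ∀ s, 0 ≤ c s) (N : ℕ) (s : ℤ) :
    c s * (min |(s : ℝ)| N / N) ≤ c s :=
  mul_le_of_le_one_right (h0 s) (div_le_one_of_le₀ (min_le_right _ _) (by positivity))

theorem exitMass_term_nonneg {c : ℤ → ℝ} (h0 : ∀ s, 0 ≤ c s) (N : ℕ) (s : ℤ) :
    0 ≤ c s * (min |(s : ℝ)| N / N) :=
  mul_nonneg (h0 s) (by positivity)

theorem exitMass_nonneg {c : ℤ → ℝ} (h0 : ∀ s, 0 ≤ c s) (N : ℕ) : 0 ≤ exitMass c N :=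
  tsum_nonneg (exitMass_term_nonneg h0 N)

theorem sum_tsum_exitSteps_le {c : ℤ → ℝ} (hc : Summable c) (h0 : ∀ s, 0 ≤ c s) {N : ℕ}
    (hN : 0 < N) :
    ∑ r ∈ Finset.range N, ∑' s, (exitSteps N r).indicator c s ≤ N * exitMass c N := by
  have hN' : (N : ℝ) ≠ 0 := by positivity
  have hs : Summable fun s => c s * (min |(s : ℝ)| N / N) :=
    Summable.of_nonneg_of_le (exitMass_term_nonneg h0 N) (exitMass_term_le h0 N) hc
  rw [← Summable.tsum_finsetSum fun r _ => hc.indicator _, exitMass, ← tsum_mul_left]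
  refine Summable.tsum_le_tsum (fun s => ?_) (summable_sum fun r _ => hc.indicator _)
    (hs.mul_left _)
  refine (sum_indicator_exitSteps_le h0 N s).trans_eq ?_
  field_simp

/-- Dominated convergence: each fixed step leaves a long block from a vanishing fraction of
positions. -/
theorem tendsto_exitMass {c : ℤ → ℝ} (hc : Summable c) (h0 : ∀ s, 0 ≤ c s) :
    Tendsto (exitMass c) atTop (nhds 0) := by
  have : Tendsto (exitMass c) atTop (nhds (∑' _ : ℤ, (0 : ℝ))) := by
    refine tendsto_tsum_of_dominated_convergence hc (fun s => ?_) (Eventually.of_forall fun N s => ?_)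
    · have h1 : Tendsto (fun N : ℕ => |(s : ℝ)| / N) atTop (nhds 0) :=
        tendsto_const_div_atTop_nhds_zero_nat _
      have h2 : Tendsto (fun N : ℕ => min |(s : ℝ)| N / N) atTop (nhds 0) :=
        squeeze_zero (fun N => by positivity)
          (fun N => div_le_div_of_nonneg_right (min_le_left _ _) (by positivity)) h1
      simpa using h2.const_mul (c s)
    · rw [Real.norm_of_nonneg (exitMass_term_nonneg h0 N s)]
      exact exitMass_term_le h0 N s
  simpa using this

end Boundary

/-! ### Multipliers on `ℓ²`, modulation and Fourier coefficients -/

section Fourier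

theorem exists_lp_eq_mul {m : ℤ → ℂ} {B : ℝ} (hm : ∀ l, ‖m l‖ ≤ B)
    (g : lp (fun _ : ℤ => ℂ) 2) :
    ∃ g' : lp (fun _ : ℤ => ℂ) 2, (∀ l, g' l = m l * g l) ∧ ‖g'‖ ≤ B * ‖g‖ := by
  have hB : 0 ≤ B := (norm_nonneg _).trans (hm 0)
  have hle : ∀ l, ‖m l * g l‖ ≤ ‖((B : ℂ) • g) l‖ := fun l => by
    rw [lp.coeFn_smul, Pi.smul_apply, norm_smul, norm_mul, Complex.norm_real,
      Real.norm_of_nonneg hB]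
    exact mul_le_mul_of_nonneg_right (hm l) (norm_nonneg _)
  have hmem : Memℓp (fun l => m l * g l) 2 := (lp.memℓp ((B : ℂ) • g)).mono' hle
  refine ⟨⟨_, hmem⟩, fun l => rfl, ?_⟩
  calc _ ≤ ‖(B : ℂ) • g‖ := lp.norm_mono (by norm_num) hle
    _ = _ := by rw [norm_smul, Complex.norm_real, Real.norm_of_nonneg hB]

/-- The product `e_s · f` in `L²`. -/
noncomputable def mulFourier (s : ℤ) (f : L2) : L2 :=
  MemLp.toLp (fun x => fourier s x * (f : Circle2Pi → ℂ) x)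
    ((Lp.memLp f).of_le ((fourier s).continuous.aestronglyMeasurable.mul
      (Lp.aestronglyMeasurable f)) (Eventually.of_forall fun x => by
        rw [norm_mul, fourier_apply, Circle.norm_coe, one_mul]))

theorem coeFn_mulFourier (s : ℤ) (f : L2) :
    (mulFourier s f : Circle2Pi → ℂ) =ᵐ[haarAddCircle] fun x => fourier s x * f x :=
  MemLp.coeFn_toLp _

theorem fourierCoeff_congr {f g : Circle2Pi → ℂ} (h : f =ᵐ[haarAddCircle] g) (n : ℤ) :
    fourierCoeff f n = fourierCoeff g n :=
  integral_congr_ae (h.mono fun x hx => by simp only [hx])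

theorem fourierCoeff_mulFourier (s : ℤ) (f : L2) (l : ℤ) :
    fourierCoeff (mulFourier s f : Circle2Pi → ℂ) l = fourierCoeff (f : Circle2Pi → ℂ) (l - s) := by
  rw [fourierCoeff_congr (coeFn_mulFourier s f)]
  refine integral_congr_ae (Eventually.of_forall fun x => ?_)
  simp only [smul_eq_mul]
  rw [← mul_assoc, ← fourier_add]
  congr 3; ring

/-- The localization principle: only the values of `e_s` where `f` does not vanish matter. -/
theorem norm_mulFourier_sub_smul_le {s : ℤ} {z : ℂ} {η : ℝ} {f : L2}
    (h : ∀ᵐ x ∂(haarAddCircle : Measure Circle2Pi), f x ≠ 0 → ‖fourier s x - z‖ ≤ η) :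
    ‖mulFourier s f - z • f‖ ≤ η * ‖f‖ := by
  refine Lp.norm_le_mul_norm_of_ae_le_mul ?_
  filter_upwards [h, coeFn_mulFourier s f, Lp.coeFn_sub (mulFourier s f) (z • f),
    Lp.coeFn_smul z f] with x hx h1 h2 h3
  rw [h2, Pi.sub_apply, h1, h3, Pi.smul_apply, smul_eq_mul, ← sub_mul, norm_mul]
  by_cases h0 : f x = 0
  · simp [h0]
  · exact mul_le_mul_of_nonneg_right (hx h0) (norm_nonneg _)

theorem repr_apply (f : L2) (l : ℤ) :
    fourierBasis.repr f l = fourierCoeff (f : Circle2Pi → ℂ) l := fourierBasis_repr f l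

theorem hasSum_entry_mul (W : L2 →L[ℂ] L2) (f : L2) (l : ℤ) :
    HasSum (fun j => entry W l j * fourierCoeff (f : Circle2Pi → ℂ) j)
      (fourierCoeff (W f : Circle2Pi → ℂ) l) := by
  have h := (hasSum_fourier_series_L2 f).mapL W
  have h2 := h.mapL (innerSL ℂ (fourierBasis l : L2))
  simp only [innerSL_apply_apply, ← HilbertBasis.repr_apply_apply, map_smul, smul_eq_mul, repr_apply] at h2
  simpa only [entry, mul_comm] using h2

theorem norm_fourier (s : ℤ) (x : Circle2Pi) : ‖fourier s x‖ = 1 := by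
  rw [fourier_apply, Circle.norm_coe]

end Fourier

/-! ### The symbol `w_l(a)` and continuity of `ρ(L_a)` -/

section DiagonalType

variable {W : L2 →L[ℂ] L2} {c : ℤ → ℝ}

theorem nonneg_of_norm_entry_le (hW : ∀ j k, ‖entry W j k‖ ≤ c (j - k)) (s : ℤ) : 0 ≤ c s := by
  simpa using (norm_nonneg _).trans (hW s 0)

theorem norm_entry_sub_le (hW : ∀ j k, ‖entry W j k‖ ≤ c (j - k)) (l s : ℤ) :
    ‖entry W l (l - s)‖ ≤ c s := by
  simpa using hW l (l - s)

theorem coeffL_eq_tsum (W : L2 →L[ℂ] L2) (a : Circle2Pi) (l : ℤ) :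
    coeffL W a l = ∑' s : ℤ, entry W l (l - s) * fourier s a := by
  unfold coeffL
  rw [← (Equiv.subLeft l).tsum_eq]
  simp

theorem norm_entry_mul_fourier_le (hW : ∀ j k, ‖entry W j k‖ ≤ c (j - k)) (a : Circle2Pi)
    (l s : ℤ) : ‖entry W l (l - s) * fourier s a‖ ≤ c s := by
  rw [norm_mul, norm_fourier, mul_one]
  exact norm_entry_sub_le hW l s

theorem summable_entry_mul_fourier (hc : Summable c) (hW : ∀ j k, ‖entry W j k‖ ≤ c (j - k))
    (a : Circle2Pi) (l : ℤ) : Summable fun s : ℤ => entry W l (l - s) * fourier s a :=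
  hc.of_norm_bounded (norm_entry_mul_fourier_le hW a l)

theorem norm_coeffL_le (hc : Summable c) (hW : ∀ j k, ‖entry W j k‖ ≤ c (j - k))
    (a : Circle2Pi) (l : ℤ) : ‖coeffL W a l‖ ≤ ∑' s, c s := by
  rw [coeffL_eq_tsum]
  exact tsum_of_norm_bounded hc.hasSum (norm_entry_mul_fourier_le hW a l)

theorem norm_fourier_sub_fourier_le (a b : Circle2Pi) (s : ℤ) :
    ‖fourier s a - fourier s b‖ ≤ 2 := by
  refine (norm_sub_le _ _).trans ?_
  rw [norm_fourier, norm_fourier]; norm_num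

theorem norm_coeffL_sub_coeffL_le (hc : Summable c) (hW : ∀ j k, ‖entry W j k‖ ≤ c (j - k))
    (a b : Circle2Pi) (l : ℤ) :
    ‖coeffL W a l - coeffL W b l‖ ≤ ∑' s, c s * ‖fourier s a - fourier s b‖ := by
  have h0 := nonneg_of_norm_entry_le hW
  rw [coeffL_eq_tsum, coeffL_eq_tsum, ← (summable_entry_mul_fourier hc hW a l).tsum_sub
    (summable_entry_mul_fourier hc hW b l)]
  have hs : Summable fun s => c s * ‖fourier s a - fourier s b‖ :=
    Summable.of_nonneg_of_le (fun s => mul_nonneg (h0 s) (norm_nonneg _))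
      (fun s => mul_le_mul_of_nonneg_left (norm_fourier_sub_fourier_le a b s) (h0 s))
      (hc.mul_right 2)
  refine tsum_of_norm_bounded hs.hasSum fun s => ?_
  rw [← mul_sub, norm_mul]
  exact mul_le_mul_of_nonneg_right (norm_entry_sub_le hW l s) (norm_nonneg _)

theorem continuous_tsum_mul_norm_fourier_sub (hc : Summable c) (h0 : ∀ s, 0 ≤ c s)
    (a : Circle2Pi) :
    Continuous fun b : Circle2Pi => ∑' s, c s * ‖fourier s a - fourier s b‖ := by
  refine continuous_tsum (fun s => ?_) (hc.mul_right 2) fun s b => ?_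
  · exact continuous_const.mul (continuous_const.sub (fourier s).continuous).norm
  · rw [Real.norm_of_nonneg (mul_nonneg (h0 s) (norm_nonneg _))]
    exact mul_le_mul_of_nonneg_left (norm_fourier_sub_fourier_le a b s) (h0 s)

/-- `ρ` is Lipschitz for the sup norm on bounded sequences, and the sup distance between the symbols
at `a` and `b` is at most `∑ c_s |e_s(a) - e_s(b)|`, which is continuous in `b` and vanishes at `b =
a`. -/
theorem continuous_rho_coeffL (hc : Summable c) (hW : ∀ j k, ‖entry W j k‖ ≤ c (j - k)) :
    Continuous fun a : Circle2Pi => rho (coeffL W a) := by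
  have h0 := nonneg_of_norm_entry_le hW
  refine continuous_iff_continuousAt.2 fun a => ?_
  set d : Circle2Pi → ℝ := fun b => ∑' s, c s * ‖fourier s a - fourier s b‖ with hd
  have hdc : Tendsto (fun b => 2 * (∑' s, c s) * d b) (nhds a) (nhds 0) := by
    have h := ((continuous_tsum_mul_norm_fourier_sub hc h0 a).tendsto a).const_mul
      (2 * (∑' s, c s))
    simpa only [sub_self, norm_zero, mul_zero, tsum_zero] using h
  refine tendsto_of_tendsto_of_dist tendsto_const_nhds ?_
  refine squeeze_zero (fun _ => dist_nonneg) (fun b => ?_) hdc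
  rw [Real.dist_eq, abs_sub_le_iff]
  have hab := norm_coeffL_sub_coeffL_le hc hW a b
  have h1 := rho_le_rho_add (norm_coeffL_le hc hW a) (norm_coeffL_le hc hW b) hab
  have h2 := rho_le_rho_add (norm_coeffL_le hc hW b) (norm_coeffL_le hc hW a)
    fun l => (norm_sub_rev _ _).trans_le (hab l)
  constructor <;> linarith

end DiagonalType

/-! ### Upper bound for `W` on functions supported near a point -/

section Upper

variable {W : L2 →L[ℂ] L2} {c : ℤ → ℝ}

theorem lp_hasSum_norm_sq (g : lp (fun _ : ℤ => ℂ) 2) :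
    HasSum (fun l => ‖g l‖ ^ 2) (‖g‖ ^ 2) := by
  simpa using lp.hasSum_norm (p := 2) (by norm_num) g

theorem hasSum_entry_mul_sub (W : L2 →L[ℂ] L2) (f : L2) (l : ℤ) :
    HasSum (fun s => entry W l (l - s) * fourierCoeff (f : Circle2Pi → ℂ) (l - s))
      (fourierCoeff (W f : Circle2Pi → ℂ) l) :=
  (Equiv.subLeft l).hasSum_iff.2 (hasSum_entry_mul W f l)

/-- If multiplication by `e_s` is close to multiplication by `e_s(a)` on `f`, then `W f` is close
to the image of `f` under the Fourier multiplier with symbol `w_l(a)`. -/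
theorem exists_lp_multiplier_near (hc : Summable c) (hW : ∀ j k, ‖entry W j k‖ ≤ c (j - k))
    (a : Circle2Pi) (f : L2) {δ : ℤ → ℝ} (hδ : Summable fun s => c s * δ s)
    (hf : ∀ s, ‖mulFourier s f - fourier s a • f‖ ≤ δ s * ‖f‖) :
    ∃ g : lp (fun _ : ℤ => ℂ) 2,
      (∀ l, g l = coeffL W a l * fourierCoeff (f : Circle2Pi → ℂ) l) ∧
      ‖fourierBasis.repr (W f) - g‖ ≤ (∑' s, c s * δ s) * ‖f‖ := by
  have h0 := nonneg_of_norm_entry_le hW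
  -- `v s` is the `s`-th diagonal applied to the error `e_s f - e_s(a) f`; these sum to `W f` minus
  -- the multiplier applied to `f`.
  choose v hv hv' using fun s => exists_lp_eq_mul (m := fun l => entry W l (l - s)) (B := c s)
    (fun l => norm_entry_sub_le hW l s) (fourierBasis.repr (mulFourier s f - fourier s a • f))
  have hb : ∀ s, ‖v s‖ ≤ c s * δ s * ‖f‖ := fun s => by
    refine (hv' s).trans ?_
    rw [LinearIsometryEquiv.norm_map, mul_assoc]
    exact mul_le_mul_of_nonneg_left (hf s) (h0 s)
  have hvs : Summable v := (hδ.mul_right ‖f‖).of_norm_bounded hb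
  have hval : ∀ l, (∑' s, v s) l =
      fourierCoeff (W f : Circle2Pi → ℂ) l -
        coeffL W a l * fourierCoeff (f : Circle2Pi → ℂ) l := by
    intro l
    have h1 : HasSum (fun s => v s l) ((∑' s, v s) l) :=
      hvs.hasSum.mapL (lp.evalCLM ℂ (fun _ : ℤ => ℂ) 2 l)
    have h2 := (hasSum_entry_mul_sub W f l).sub
      ((summable_entry_mul_fourier hc hW a l).hasSum.mul_right
        (fourierCoeff (f : Circle2Pi → ℂ) l))
    rw [← coeffL_eq_tsum] at h2
    refine h1.unique (h2.congr_fun fun s => ?_)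
    rw [hv, map_sub, map_smul]
    simp only [lp.coeFn_sub, lp.coeFn_smul, Pi.sub_apply, Pi.smul_apply, repr_apply,
      fourierCoeff_mulFourier, smul_eq_mul]
    ring
  refine ⟨fourierBasis.repr (W f) - ∑' s, v s, fun l => ?_, ?_⟩
  · rw [lp.coeFn_sub, Pi.sub_apply, hval, repr_apply]; ring
  · rw [sub_sub_cancel, ← tsum_mul_right]
    exact tsum_of_norm_bounded (hδ.mul_right ‖f‖).hasSum hb

/-- Up to the error `C * η * ‖f‖`, `‖g‖` is at most the norm of the multiplier applied to `e_r f`,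
for every `r < N`. The square of the latter is `∑_m |w_{m+r}|² |f̂(m)|²`, so summing over `r` puts a
window sum in front of each `|f̂(m)|²`. -/
theorem norm_le_of_sum_range_le {w : ℤ → ℂ} {C R η : ℝ} {N : ℕ} (hN : 0 < N) (hR : 0 ≤ R)
    (hC : ∀ l, ‖w l‖ ≤ C)
    (h : ∀ m : ℤ, ∑ r ∈ Finset.range N, ‖w (m + r)‖ ^ 2 ≤ N * R) (f : L2) {z : ℕ → ℂ}
    (hz : ∀ r, ‖z r‖ = 1)
    (hf : ∀ r < N, ‖mulFourier r f - z r • f‖ ≤ η * ‖f‖) (g : lp (fun _ : ℤ => ℂ) 2)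
    (hg : ∀ l, g l = w l * fourierCoeff (f : Circle2Pi → ℂ) l) :
    ‖g‖ ≤ (√R + C * η) * ‖f‖ := by
  have hC0 : 0 ≤ C := (norm_nonneg _).trans (hC 0)
  choose G hG hG' using fun r : ℕ =>
    exists_lp_eq_mul hC (fourierBasis.repr (mulFourier r f))
  have h1 : ∀ r < N, ‖g‖ - C * η * ‖f‖ ≤ ‖G r‖ := by
    intro r hr
    obtain ⟨d, hd, hd'⟩ := exists_lp_eq_mul hC (fourierBasis.repr (mulFourier r f - z r • f))
    have heq : G r - d = z r • g := by
      ext l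
      simp only [lp.coeFn_sub, lp.coeFn_smul, Pi.sub_apply, Pi.smul_apply, hG, hd, hg, map_sub,
        map_smul, repr_apply, smul_eq_mul]
      ring
    have h2 : ‖g‖ = ‖G r - d‖ := by rw [heq, norm_smul, hz, one_mul]
    have h3 : ‖d‖ ≤ C * (η * ‖f‖) := by
      refine hd'.trans (mul_le_mul_of_nonneg_left ?_ hC0)
      rw [LinearIsometryEquiv.norm_map]; exact hf r hr
    have h4 := norm_sub_le (G r) d
    linarith
  have h2 : ∑ r ∈ Finset.range N, ‖G r‖ ^ 2 ≤ N * R * ‖f‖ ^ 2 := by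
    have hs : ∀ r : ℕ, HasSum (fun m : ℤ => ‖w (m + r)‖ ^ 2 * ‖fourierBasis.repr f m‖ ^ 2)
        (‖G r‖ ^ 2) := fun r => by
      refine ((Equiv.addRight (r : ℤ)).hasSum_iff.2 (lp_hasSum_norm_sq (G r))).congr_fun
        fun m => ?_
      simp only [Function.comp, Equiv.coe_addRight, hG, repr_apply, fourierCoeff_mulFourier,
        add_sub_cancel_right, norm_mul, mul_pow]
    have hsum := hasSum_sum (s := Finset.range N) fun r _ => hs r
    have hf2 := (lp_hasSum_norm_sq (fourierBasis.repr f)).mul_left (N * R)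
    rw [LinearIsometryEquiv.norm_map] at hf2
    refine hasSum_le (fun m => ?_) hsum hf2
    rw [← Finset.sum_mul]
    exact mul_le_mul_of_nonneg_right (h m) (by positivity)
  by_cases hneg : ‖g‖ - C * η * ‖f‖ ≤ 0
  · have : 0 ≤ √R * ‖f‖ := by positivity
    linarith
  · push Not at hneg
    have h3 : (N : ℝ) * (‖g‖ - C * η * ‖f‖) ^ 2 ≤ N * R * ‖f‖ ^ 2 := by
      refine le_trans ?_ h2
      calc _ = ∑ r ∈ Finset.range N, (‖g‖ - C * η * ‖f‖) ^ 2 := by simp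
        _ ≤ _ := Finset.sum_le_sum fun r hr =>
          pow_le_pow_left₀ hneg.le (h1 r (Finset.mem_range.1 hr)) 2
    rw [mul_assoc (N : ℝ)] at h3
    have h4 := le_of_mul_le_mul_left h3 (by positivity)
    have h5 := Real.le_sqrt_of_sq_le h4
    rw [Real.sqrt_mul hR, Real.sqrt_sq (norm_nonneg _)] at h5
    linarith

theorem exists_open_norm_apply_le (hc : Summable c) (hW : ∀ j k, ‖entry W j k‖ ≤ c (j - k))
    (a : Circle2Pi) {η : ℝ} (hη : 0 < η) :
    ∃ U : Set Circle2Pi, IsOpen U ∧ a ∈ U ∧ ∀ f : L2,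
      (∀ᵐ x ∂(haarAddCircle : Measure Circle2Pi), f x ≠ 0 → x ∈ U) →
      ‖W f‖ ≤ (√(rho (coeffL W a) + η) + (2 * (∑' s, c s) + 2) * η) * ‖f‖ := by
  classical
  have h0 := nonneg_of_norm_entry_le hW
  have hC := norm_coeffL_le hc hW a
  have hC0 : 0 ≤ ∑' s, c s := tsum_nonneg h0
  obtain ⟨N, hN, hNle⟩ := exists_sum_range_le hC hη
  have hρ := rho_nonneg hC
  obtain ⟨S₀, hS₀⟩ := (hc.hasSum.eventually (lt_mem_nhds (sub_lt_self _ hη))).exists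
  -- `S` holds the diagonals carrying all but `η` of the mass of `c`, and also the shifts `0, …, N -
  -- 1` used in the averaging.
  set S : Finset ℤ := S₀ ∪ (Finset.range N).image fun r : ℕ => (r : ℤ) with hS
  have hSc : ∑' s, c s - η ≤ ∑ s ∈ S, c s :=
    hS₀.le.trans (Finset.sum_le_sum_of_subset_of_nonneg Finset.subset_union_left
      fun s _ _ => h0 s)
  refine ⟨⋂ s ∈ S, {x | ‖fourier s x - fourier s a‖ < η}, ?_, ?_, fun f hf => ?_⟩
  · refine isOpen_biInter_finset fun s _ => ?_
    exact isOpen_lt ((fourier s).continuous.sub continuous_const).norm continuous_const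
  · simp [hη]
  · have hδ : ∀ s, ‖mulFourier s f - fourier s a • f‖ ≤ (if s ∈ S then η else 2) * ‖f‖ := by
      intro s
      refine norm_mulFourier_sub_smul_le ?_
      filter_upwards [hf] with x hx hx0
      split_ifs with hs
      · have := Set.mem_iInter₂.1 (hx hx0) s hs
        exact le_of_lt this
      · exact norm_fourier_sub_fourier_le _ _ _
    have hle : ∀ s, c s * (if s ∈ S then η else 2) ≤
        c s * η + 2 * (c s - (S : Set ℤ).indicator c s) := by
      intro s
      have := h0 s
      by_cases hs : s ∈ S
      · simp [hs]
      · simp only [hs, if_false, Finset.mem_coe, not_false_eq_true, Set.indicator_of_notMem]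
        nlinarith
    have hR : Summable fun s => c s * η + 2 * (c s - (S : Set ℤ).indicator c s) :=
      (hc.mul_right η).add ((hc.sub (hc.indicator _)).mul_left 2)
    have hsum : Summable fun s => c s * (if s ∈ S then η else 2) :=
      Summable.of_nonneg_of_le (fun s => mul_nonneg (h0 s) (by split_ifs <;> positivity)) hle hR
    obtain ⟨g, hg, hg'⟩ := exists_lp_multiplier_near hc hW a f hsum hδ
    have hgn := norm_le_of_sum_range_le (R := rho (coeffL W a) + η) hN (by positivity) hC
      hNle f (z := fun r => fourier r a) (fun r => norm_fourier _ _) (fun r hr => by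
        have hrS : (r : ℤ) ∈ S := Finset.mem_union_right _
          (Finset.mem_image_of_mem _ (Finset.mem_range.2 hr))
        simpa [hrS] using hδ r) g hg
    -- Diagonals in `S` contribute at most `η ∑ c`, the others at most `2 * η`. The averaging adds
    -- another `η ∑ c`, whence the constant `2 ∑ c + 2`.
    have hts : ∑' s, c s * (if s ∈ S then η else 2) ≤ (∑' s, c s + 2) * η := by
      refine (hsum.tsum_le_tsum hle hR).trans ?_
      have hSt : ∑' s, (S : Set ℤ).indicator c s = ∑ s ∈ S, c s := by
        rw [← tsum_subtype (S : Set ℤ) c, Finset.tsum_subtype' S c]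
      rw [(hc.mul_right η).tsum_add ((hc.sub (hc.indicator _)).mul_left 2), tsum_mul_right,
        tsum_mul_left, hc.tsum_sub (hc.indicator _), hSt]
      linarith
    have h1 : ‖W f‖ = ‖fourierBasis.repr (W f)‖ := (LinearIsometryEquiv.norm_map _ _).symm
    have h2 := norm_le_norm_add_norm_sub g (fourierBasis.repr (W f))
    rw [norm_sub_rev] at h2
    have h3 := mul_le_mul_of_nonneg_right hts (norm_nonneg f)
    rw [h1]
    nlinarith [norm_nonneg f]

end Upper

/-! ### Test functions and Fejér means of indicators -/

section Fejer

/-- The trigonometric polynomial `∑_{m ≤ j < m + N} e^{ij(x - a)}`. -/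
noncomputable def dirichletBlock (N : ℕ) (m : ℤ) (a : Circle2Pi) : L2 :=
  ∑ r ∈ Finset.range N, fourier (-(m + r)) a • (fourierLp 2 (m + r) : L2)

/-- The `N`-th Cesàro mean at `a` of the Fourier series of `1_Z`. -/
noncomputable def cesaroIndicator (Z : Set Circle2Pi) (N : ℕ) (a : Circle2Pi) : ℝ :=
  (∑ r ∈ Finset.range N, ∑ q ∈ Finset.range N,
    fourier ((r : ℤ) - q) a * fourierCoeff (Z.indicator fun _ => (1 : ℂ)) ((r : ℤ) - q)).re / N

theorem norm_sq_dirichletBlock (N : ℕ) (m : ℤ) (a : Circle2Pi) :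
    ‖dirichletBlock N m a‖ ^ 2 = N := by
  have ho : Orthonormal ℂ fun r : ℕ => (fourierLp 2 (m + r) : L2) :=
    orthonormal_fourier.comp (fun r : ℕ => m + (r : ℤ)) fun r q h => by simpa using h
  have h : inner ℂ (dirichletBlock N m a) (dirichletBlock N m a) = (N : ℂ) := by
    unfold dirichletBlock
    rw [ho.inner_sum]
    simp [Complex.conj_mul', norm_fourier, -fourier_apply]
  rw [← @inner_self_eq_norm_sq ℂ, h]
  exact Complex.natCast_re N

theorem inner_proj_fourierLp (Z : Set Circle2Pi) (hZ : MeasurableSet Z) (j k : ℤ) :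
    inner ℂ (proj haarAddCircle Z hZ (fourierLp 2 j)) (proj haarAddCircle Z hZ (fourierLp 2 k)) =
      fourierCoeff (Z.indicator fun _ => (1 : ℂ)) (j - k) := by
  rw [L2.inner_def]
  refine integral_congr_ae ?_
  filter_upwards [coeFn_indicatorLp haarAddCircle Z hZ (fourierLp 2 j),
    coeFn_indicatorLp haarAddCircle Z hZ (fourierLp 2 k), coeFn_fourierLp 2 j,
    coeFn_fourierLp 2 k] with x h1 h2 h3 h4
  change inner ℂ (indicatorLp haarAddCircle Z hZ (fourierLp 2 j) x)
    (indicatorLp haarAddCircle Z hZ (fourierLp 2 k) x) = _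
  rw [h1, h2]
  by_cases hx : x ∈ Z
  · rw [Set.indicator_of_mem hx, Set.indicator_of_mem hx, Set.indicator_of_mem hx, h3, h4,
      RCLike.inner_apply, ← fourier_neg, ← fourier_add, smul_eq_mul, mul_one]
    congr 2; ring
  · simp [Set.indicator_of_notMem hx]

/-- In the double sum the phases combine to `e_{r-q}(a)`, so the value does not depend on the
position `m` of the block. -/
theorem norm_sq_proj_dirichletBlock (Z : Set Circle2Pi) (hZ : MeasurableSet Z) {N : ℕ}
    (hN : 0 < N) (m : ℤ) (a : Circle2Pi) :
    ‖proj haarAddCircle Z hZ (dirichletBlock N m a)‖ ^ 2 = N * cesaroIndicator Z N a := by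
  have hN' : (N : ℝ) ≠ 0 := by positivity
  rw [cesaroIndicator, mul_div_cancel₀ _ hN', ← @inner_self_eq_norm_sq ℂ, dirichletBlock, map_sum,
    sum_inner]
  refine congrArg Complex.re (Finset.sum_congr rfl fun r _ => ?_)
  rw [inner_sum]
  refine Finset.sum_congr rfl fun q _ => ?_
  rw [map_smul, map_smul, inner_smul_left, inner_smul_right, inner_proj_fourierLp, ← mul_assoc,
    ← fourier_neg, ← fourier_add, add_sub_add_left_eq_sub,
    show -(-(m + (r : ℤ))) + -(m + q) = r - q by ring]

theorem setIntegral_fourier {Y : Set Circle2Pi} (hY : MeasurableSet Y) (n : ℤ) :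
    ∫ a in Y, fourier n a ∂haarAddCircle =
      fourierCoeff (Y.indicator fun _ => (1 : ℂ)) (-n) := by
  rw [← integral_indicator hY]
  refine integral_congr_ae (Eventually.of_forall fun x => ?_)
  by_cases hx : x ∈ Y <;> simp [hx, -fourier_apply]

theorem continuous_cesaroIndicator (Z : Set Circle2Pi) (N : ℕ) :
    Continuous (cesaroIndicator Z N) := by
  unfold cesaroIndicator
  refine (Complex.continuous_re.comp ?_).div_const _
  exact continuous_finsetSum _ fun r _ => continuous_finsetSum _ fun q _ =>
    (fourier _).continuous.mul continuous_const

theorem integrable_of_continuous {E : Type*} [NormedAddCommGroup E] {g : Circle2Pi → E}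
    (hg : Continuous g) : Integrable g haarAddCircle :=
  hg.integrable_of_hasCompactSupport (HasCompactSupport.of_compactSpace g)

/-- The products of the Fourier coefficients of `1_Yᶜ` at `n` and of `1_Y` at `-n`. -/
noncomputable def complCoeffMul (Y : Set Circle2Pi) (n : ℤ) : ℂ :=
  fourierCoeff (Yᶜ.indicator fun _ => (1 : ℂ)) n * fourierCoeff (Y.indicator fun _ => (1 : ℂ)) (-n)

/-- Parseval for the orthogonal functions `1_Y` and `1_Yᶜ`. -/
theorem hasSum_complCoeffMul {Y : Set Circle2Pi} (hY : MeasurableSet Y) :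
    HasSum (complCoeffMul Y) 0 := by
  have hYt : (haarAddCircle : Measure Circle2Pi) Y ≠ ∞ := measure_ne_top _ _
  have hYct : (haarAddCircle : Measure Circle2Pi) Yᶜ ≠ ∞ := measure_ne_top _ _
  set u : L2 := indicatorConstLp 2 hY hYt 1
  set v : L2 := indicatorConstLp 2 hY.compl hYct 1
  have h := fourierBasis.hasSum_inner_mul_inner u v
  have h0 : inner ℂ u v = (0 : ℂ) := by
    rw [L2.inner_def, ← integral_zero Circle2Pi ℂ]
    refine integral_congr_ae ?_
    filter_upwards [indicatorConstLp_coeFn (p := 2) (hs := hY) (hμs := hYt) (c := (1 : ℂ)),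
      indicatorConstLp_coeFn (p := 2) (hs := hY.compl) (hμs := hYct) (c := (1 : ℂ))]
      with x h1 h2
    rw [h1, h2]
    by_cases hx : x ∈ Y <;> simp [hx]
  rw [h0] at h
  refine h.congr_fun fun n => ?_
  have h1 : inner ℂ (fourierBasis n) v = fourierCoeff (Yᶜ.indicator fun _ => (1 : ℂ)) n := by
    rw [← HilbertBasis.repr_apply_apply, repr_apply]
    exact fourierCoeff_congr indicatorConstLp_coeFn n
  have h2 : inner ℂ u (fourierBasis n) = fourierCoeff (Y.indicator fun _ => (1 : ℂ)) (-n) := by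
    rw [L2.inner_def, coe_fourierBasis]
    refine integral_congr_ae ?_
    filter_upwards [indicatorConstLp_coeFn (p := 2) (hs := hY) (hμs := hYt) (c := (1 : ℂ)),
      coeFn_fourierLp 2 n] with x h1 h2
    rw [h1, h2]
    by_cases hx : x ∈ Y <;> simp [hx, -fourier_apply]
  rw [h1, h2, complCoeffMul, mul_comm]

/-- The integral is the mean over `r` of the row sums of `complCoeffMul Y (r - q)`, `q < N`. A
complete row sums to zero, so a truncated one is minus the mass that leaves the block. -/
theorem setIntegral_cesaroIndicator_compl_le {Y : Set Circle2Pi} (hY : MeasurableSet Y) {N : ℕ}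
    (hN : 0 < N) :
    ∫ a in Y, cesaroIndicator Yᶜ N a ∂haarAddCircle ≤
      exitMass (fun n => ‖complCoeffMul Y n‖) N := by
  have hp := hasSum_complCoeffMul hY
  have hpn : Summable fun n => ‖complCoeffMul Y n‖ := hp.summable.norm
  have hi : ∀ (n : ℤ) (z : ℂ), Integrable (fun a : Circle2Pi => fourier n a * z)
      (haarAddCircle.restrict Y) := fun n z =>
    (integrable_of_continuous ((fourier n).continuous.mul continuous_const)).restrict
  have h1 : ∫ a in Y, cesaroIndicator Yᶜ N a ∂haarAddCircle =
      (∑ r ∈ Finset.range N, ∑ q ∈ Finset.range N, complCoeffMul Y ((r : ℤ) - q)).re / N := by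
    unfold cesaroIndicator
    rw [integral_div]
    congr 1
    refine (integral_re (𝕜 := ℂ) (integrable_finsetSum _ fun r _ =>
      integrable_finsetSum _ fun q _ => hi _ _)).trans (congrArg Complex.re ?_)
    rw [integral_finsetSum _ fun r _ => integrable_finsetSum _ fun q _ => hi _ _]
    refine Finset.sum_congr rfl fun r _ => ?_
    rw [integral_finsetSum _ fun q _ => hi _ _]
    refine Finset.sum_congr rfl fun q _ => ?_
    rw [integral_mul_const, setIntegral_fourier hY, complCoeffMul, mul_comm]
  rw [h1, div_le_iff₀ (by positivity), mul_comm]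
  refine (Complex.re_le_norm _).trans ((norm_sum_le _ _).trans ?_)
  refine le_trans (Finset.sum_le_sum fun r _ => ?_)
    (sum_tsum_exitSteps_le hpn (fun n => norm_nonneg _) hN)
  have h2 := tsum_eq_sum_range_add hp.summable N r
  rw [hp.tsum_eq] at h2
  rw [eq_neg_of_add_eq_zero_left h2.symm, norm_neg]
  refine tsum_of_norm_bounded (hpn.indicator _).hasSum fun s => ?_
  rw [norm_indicator_eq_indicator_norm]

end Fejer

/-! ### Lower bound on a single cell -/

section Lower

variable {W : L2 →L[ℂ] L2} {c : ℤ → ℝ}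

theorem fourierCoeff_apply_dirichletBlock (W : L2 →L[ℂ] L2) (N : ℕ) (m : ℤ) (a : Circle2Pi)
    (l : ℤ) : fourierCoeff (W (dirichletBlock N m a) : Circle2Pi → ℂ) l =
      ∑ q ∈ Finset.range N, entry W l (m + q) * fourier (-(m + q)) a := by
  rw [← repr_apply, dirichletBlock, map_sum, map_sum, lp.coeFn_sum, Finset.sum_apply]
  refine Finset.sum_congr rfl fun q _ => ?_
  rw [map_smul, map_smul, lp.coeFn_smul, Pi.smul_apply, repr_apply, smul_eq_mul, mul_comm]
  rfl

theorem norm_coeffL_le_add (hc : Summable c) (hW : ∀ j k, ‖entry W j k‖ ≤ c (j - k))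
    (a : Circle2Pi) (N : ℕ) (m : ℤ) (r : ℕ) :
    ‖coeffL W a (m + r)‖ ≤ ‖fourierCoeff (W (dirichletBlock N m a) : Circle2Pi → ℂ) (m + r)‖ +
      ∑' s, (exitSteps N r).indicator c s := by
  have hs := summable_entry_mul_fourier hc hW a (m + r)
  rw [coeffL_eq_tsum, tsum_eq_sum_range_add hs N r]
  refine (norm_add_le _ _).trans (add_le_add (le_of_eq ?_) ?_)
  -- The unimodular factor `e_{-(m+r)}(a)` turns the phases `e_{r-q}(a)` of the symbol into the
  -- phases `e_{-(m+q)}(a)` of the block.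
  · rw [fourierCoeff_apply_dirichletBlock, ← one_mul ‖_‖, ← norm_fourier (-(m + r)) a, ← norm_mul,
      Finset.mul_sum]
    refine congrArg norm (Finset.sum_congr rfl fun q _ => ?_)
    rw [mul_left_comm, ← fourier_add, show -(m + (r : ℤ)) + (r - q) = -(m + q) by ring,
      show m + (r : ℤ) - (r - q) = m + q by ring]
  · refine tsum_of_norm_bounded (hc.indicator _).hasSum fun s => ?_
    rw [norm_indicator_eq_indicator_norm]
    exact Set.indicator_le_indicator (norm_entry_mul_fourier_le hW a _ s)

/-- The weights keep the constant of the main term close to `1`, at the price of a large one on a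
term that will vanish. -/
theorem add_sq_le_of_pos {η : ℝ} (hη : 0 < η) (x y : ℝ) :
    (x + y) ^ 2 ≤ (1 + η) * x ^ 2 + (1 + 1 / η) * y ^ 2 := by
  have h : (1 + η) * x ^ 2 + (1 + 1 / η) * y ^ 2 - (x + y) ^ 2 = (η * x - y) ^ 2 / η := by
    field_simp; ring
  have : 0 ≤ (η * x - y) ^ 2 / η := by positivity
  linarith

theorem sum_norm_coeffL_sq_le (hc : Summable c) (hW : ∀ j k, ‖entry W j k‖ ≤ c (j - k))
    (a : Circle2Pi) {N : ℕ} (hN : 0 < N) (m : ℤ) {η : ℝ} (hη : 0 < η) :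
    ∑ r ∈ Finset.range N, ‖coeffL W a (m + r)‖ ^ 2 ≤
      (1 + η) * ‖W (dirichletBlock N m a)‖ ^ 2 +
        (1 + 1 / η) * ((∑' s, c s) * (N * exitMass c N)) := by
  have h0 := nonneg_of_norm_entry_le hW
  set g := W (dirichletBlock N m a)
  set t : ℕ → ℝ := fun r => ∑' s, (exitSteps N r).indicator c s with ht
  have ht0 : ∀ r, 0 ≤ t r := fun r => tsum_nonneg fun s => Set.indicator_nonneg (fun s _ => h0 s) s
  have htC : ∀ r, t r ≤ ∑' s, c s := fun r =>
    (hc.indicator _).tsum_le_tsum (fun s => Set.indicator_le_self' (fun s _ => h0 s) s) hc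
  have h1 : ∑ r ∈ Finset.range N, ‖fourierCoeff (g : Circle2Pi → ℂ) (m + r)‖ ^ 2 ≤ ‖g‖ ^ 2 := by
    have hinj : Function.Injective fun r : ℕ => m + (r : ℤ) := fun r q h => by simpa using h
    have := sum_le_hasSum ((Finset.range N).image fun r : ℕ => m + (r : ℤ))
      (fun _ _ => by positivity) (lp_hasSum_norm_sq (fourierBasis.repr g))
    rw [Finset.sum_image hinj.injOn, LinearIsometryEquiv.norm_map] at this
    simpa only [repr_apply] using this
  -- One factor `t r` is bounded by the total mass of `c`, leaving a sum linear in the exit mass.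
  have h2 : ∑ r ∈ Finset.range N, t r ^ 2 ≤ (∑' s, c s) * (N * exitMass c N) := by
    calc _ ≤ ∑ r ∈ Finset.range N, (∑' s, c s) * t r := Finset.sum_le_sum fun r _ => by
          rw [sq]; exact mul_le_mul_of_nonneg_right (htC r) (ht0 r)
      _ ≤ _ := by
          rw [← Finset.mul_sum]
          exact mul_le_mul_of_nonneg_left (sum_tsum_exitSteps_le hc h0 hN) (tsum_nonneg h0)
  calc _ ≤ ∑ r ∈ Finset.range N, ((1 + η) * ‖fourierCoeff (g : Circle2Pi → ℂ) (m + r)‖ ^ 2 +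
        (1 + 1 / η) * t r ^ 2) := Finset.sum_le_sum fun r _ =>
        (pow_le_pow_left₀ (norm_nonneg _) (norm_coeffL_le_add hc hW a N m r) 2).trans
          (add_sq_le_of_pos hη _ _)
    _ ≤ _ := by
        rw [Finset.sum_add_distrib, ← Finset.mul_sum, ← Finset.mul_sum]
        exact add_le_add (mul_le_mul_of_nonneg_left h1 (by positivity))
          (mul_le_mul_of_nonneg_left h2 (by positivity))

theorem proj_add_proj_compl {Y : Set Circle2Pi} (hY : MeasurableSet Y) (f : L2) :
    proj haarAddCircle Y hY f + proj haarAddCircle Yᶜ hY.compl f = f := by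
  refine Lp.ext ?_
  filter_upwards [coeFn_indicatorLp haarAddCircle Y hY f,
    coeFn_indicatorLp haarAddCircle Yᶜ hY.compl f, Lp.coeFn_add (proj haarAddCircle Y hY f)
      (proj haarAddCircle Yᶜ hY.compl f)] with x h1 h2 h3
  rw [h3, Pi.add_apply]
  change indicatorLp haarAddCircle Y hY f x + indicatorLp haarAddCircle Yᶜ hY.compl f x = _
  rw [h1, h2, Set.indicator_self_add_compl_apply]

theorem norm_apply_sq_le (W : L2 →L[ℂ] L2) {Y : Set Circle2Pi} (hY : MeasurableSet Y) {η : ℝ}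
    (hη : 0 < η) (f : L2) :
    ‖W f‖ ^ 2 ≤ (1 + η) * (‖W ∘L proj haarAddCircle Y hY‖ ^ 2 * ‖f‖ ^ 2) +
      (1 + 1 / η) * (‖W‖ ^ 2 * ‖proj haarAddCircle Yᶜ hY.compl f‖ ^ 2) := by
  rw [← mul_pow, ← mul_pow]
  refine le_trans (pow_le_pow_left₀ (norm_nonneg _) ?_ 2) (add_sq_le_of_pos hη _ _)
  calc ‖W f‖ = ‖(W ∘L proj haarAddCircle Y hY) f + W (proj haarAddCircle Yᶜ hY.compl f)‖ := by
        rw [ContinuousLinearMap.comp_apply, ← map_add, proj_add_proj_compl]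
    _ ≤ _ := (norm_add_le _ _).trans (add_le_add (ContinuousLinearMap.le_opNorm _ _)
        (ContinuousLinearMap.le_opNorm _ _))

/-- The estimate on the block at `m` is uniform in `m`, hence bounds `ρ`. The square on `1 + η`
comes from splitting twice: off the boundary terms, then off the part outside `Y`. -/
theorem rho_coeffL_le (hc : Summable c) (hW : ∀ j k, ‖entry W j k‖ ≤ c (j - k))
    {Y : Set Circle2Pi} (hY : MeasurableSet Y) {η : ℝ} (hη : 0 < η) {N : ℕ} (hN : 0 < N)
    (a : Circle2Pi) :
    rho (coeffL W a) ≤ (1 + η) ^ 2 * ‖W ∘L proj haarAddCircle Y hY‖ ^ 2 +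
      (1 + 1 / η) * ((∑' s, c s) * exitMass c N) +
      (1 + η) * (1 + 1 / η) * ‖W‖ ^ 2 * cesaroIndicator Yᶜ N a := by
  have h0 := nonneg_of_norm_entry_le hW
  have hC0 : 0 ≤ ∑' s, c s := tsum_nonneg h0
  have hE := exitMass_nonneg h0 N
  have hces : 0 ≤ cesaroIndicator Yᶜ N a := by
    have h := norm_sq_proj_dirichletBlock Yᶜ hY.compl hN 0 a
    exact nonneg_of_mul_nonneg_right (h ▸ sq_nonneg _ : 0 ≤ (N : ℝ) * _) (by positivity)
  refine rho_le_of_sum_range_le hN (by positivity) fun m => ?_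
  refine (sum_norm_coeffL_sq_le hc hW a hN m hη).trans ?_
  have h := norm_apply_sq_le W hY hη (dirichletBlock N m a)
  rw [norm_sq_dirichletBlock, norm_sq_proj_dirichletBlock _ _ hN] at h
  have h' := mul_le_mul_of_nonneg_left h (by positivity : 0 ≤ 1 + η)
  linarith

/-- After integrating over `Y`, `N → ∞` at fixed `η` removes both error terms; only then `η → 0`. -/
theorem setIntegral_rho_coeffL_le (hc : Summable c) (hW : ∀ j k, ‖entry W j k‖ ≤ c (j - k))
    {Y : Set Circle2Pi} (hY : MeasurableSet Y) :
    ∫ a in Y, rho (coeffL W a) ∂haarAddCircle ≤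
      (haarAddCircle : Measure Circle2Pi).real Y * ‖W ∘L proj haarAddCircle Y hY‖ ^ 2 := by
  have h0 := nonneg_of_norm_entry_le hW
  set K := ‖W ∘L proj haarAddCircle Y hY‖
  set μY := (haarAddCircle : Measure Circle2Pi).real Y with hμY
  set p : ℤ → ℝ := fun n => ‖complCoeffMul Y n‖
  have hp : Summable p := (hasSum_complCoeffMul hY).summable.norm
  have hη : ∀ η : ℝ, 0 < η →
      ∫ a in Y, rho (coeffL W a) ∂haarAddCircle ≤ μY * ((1 + η) ^ 2 * K ^ 2) := by
    intro η hη
    have hN : ∀ N : ℕ, 0 < N → ∫ a in Y, rho (coeffL W a) ∂haarAddCircle ≤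
        μY * ((1 + η) ^ 2 * K ^ 2 + (1 + 1 / η) * ((∑' s, c s) * exitMass c N)) +
          (1 + η) * (1 + 1 / η) * ‖W‖ ^ 2 * exitMass p N := by
      intro N hN
      have hces := (integrable_of_continuous (continuous_cesaroIndicator Yᶜ N)).restrict (s := Y)
      refine (integral_mono (integrable_of_continuous (continuous_rho_coeffL hc hW)).restrict
        ((integrable_const _).add (hces.const_mul _))
        (rho_coeffL_le hc hW hY hη hN)).trans ?_
      rw [integral_add' (integrable_const _) (hces.const_mul _), integral_const_mul,
        setIntegral_const, smul_eq_mul]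
      exact add_le_add le_rfl (mul_le_mul_of_nonneg_left
        (setIntegral_cesaroIndicator_compl_le hY hN) (by positivity))
    have hlim : Tendsto (fun N : ℕ =>
        μY * ((1 + η) ^ 2 * K ^ 2 + (1 + 1 / η) * ((∑' s, c s) * exitMass c N)) +
          (1 + η) * (1 + 1 / η) * ‖W‖ ^ 2 * exitMass p N) atTop
        (nhds (μY * ((1 + η) ^ 2 * K ^ 2 + (1 + 1 / η) * ((∑' s, c s) * 0)) +
          (1 + η) * (1 + 1 / η) * ‖W‖ ^ 2 * 0)) :=
      ((((((tendsto_exitMass hc h0).const_mul _).const_mul _).const_add _).const_mul _).add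
        ((tendsto_exitMass hp fun n => norm_nonneg _).const_mul _))
    have := ge_of_tendsto hlim ((eventually_gt_atTop 0).mono hN)
    simpa using this
  have hcont : Tendsto (fun η : ℝ => μY * ((1 + η) ^ 2 * K ^ 2)) (nhdsWithin 0 (Set.Ioi 0))
      (nhds (μY * ((1 + 0) ^ 2 * K ^ 2))) :=
    ((by fun_prop : Continuous fun η : ℝ => μY * ((1 + η) ^ 2 * K ^ 2)).tendsto 0).mono_left
      nhdsWithin_le_nhds
  have := ge_of_tendsto hcont (eventually_nhdsWithin_of_forall hη)
  simpa using this

end Lower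

/-! ### Partitions and the integral formula -/

section Main

variable {W : L2 →L[ℂ] L2} {c : ℤ → ℝ}

theorem integral_rho_coeffL_le_partitionSum (hc : Summable c)
    (hW : ∀ j k, ‖entry W j k‖ ≤ c (j - k))
    (χ : FinitePartition (haarAddCircle : Measure Circle2Pi)) :
    ∫ a, rho (coeffL W a) ∂haarAddCircle ≤ partitionSum W χ := by
  have hi := integrable_of_continuous (continuous_rho_coeffL hc hW)
  have hU : (⋃ j, χ.cell j) =ᵐ[haarAddCircle] (Set.univ : Set Circle2Pi) :=
    ae_eq_univ.2 χ.measure_compl_iUnion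
  rw [← setIntegral_univ, ← setIntegral_congr_set hU,
    integral_iUnion_ae (fun j => (χ.measurableSet_cell j).nullMeasurableSet)
      (fun j k hjk => χ.measure_inter j k hjk) hi.integrableOn, tsum_fintype]
  exact Finset.sum_le_sum fun j _ => setIntegral_rho_coeffL_le hc hW (χ.measurableSet_cell j)

theorem exists_open_norm_comp_proj_sq_le (hc : Summable c)
    (hW : ∀ j k, ‖entry W j k‖ ≤ c (j - k)) (a : Circle2Pi) {ε : ℝ} (hε : 0 < ε) :
    ∃ U : Set Circle2Pi, IsOpen U ∧ a ∈ U ∧ ∀ (Y : Set Circle2Pi) (hY : MeasurableSet Y),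
      Y ⊆ U → ‖W ∘L proj haarAddCircle Y hY‖ ^ 2 ≤ rho (coeffL W a) + ε := by
  set D := 2 * (∑' s, c s) + 2
  have hρ := rho_nonneg (norm_coeffL_le hc hW a)
  have hD : 0 ≤ D := by
    have : 0 ≤ ∑' s, c s := tsum_nonneg (nonneg_of_norm_entry_le hW)
    positivity
  have hlim : Tendsto (fun η : ℝ => (√(rho (coeffL W a) + η) + D * η) ^ 2)
      (nhdsWithin 0 (Set.Ioi 0)) (nhds ((√(rho (coeffL W a) + 0) + D * 0) ^ 2)) :=
    ((by fun_prop : Continuous fun η : ℝ =>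
      (√(rho (coeffL W a) + η) + D * η) ^ 2).tendsto 0).mono_left nhdsWithin_le_nhds
  rw [add_zero, mul_zero, add_zero, Real.sq_sqrt hρ] at hlim
  obtain ⟨η, hη, hη0⟩ := ((hlim.eventually (gt_mem_nhds (lt_add_of_pos_right _ hε))).and
    self_mem_nhdsWithin).exists
  have hη0 : 0 < η := hη0
  obtain ⟨U, hUo, haU, hU⟩ := exists_open_norm_apply_le hc hW a hη0
  refine ⟨U, hUo, haU, fun Y hY hYU => le_trans (pow_le_pow_left₀ (norm_nonneg _) ?_ 2) hη.le⟩
  refine ContinuousLinearMap.opNorm_le_bound _ (by positivity) fun f => ?_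
  refine (hU (proj haarAddCircle Y hY f) ?_).trans
    (mul_le_mul_of_nonneg_left ?_ (by positivity))
  · filter_upwards [coeFn_indicatorLp haarAddCircle Y hY f] with x hx h0
    refine hYU (by_contra fun hxY => h0 ?_)
    exact hx.trans (Set.indicator_of_notMem hxY _)
  · exact (norm_indicatorLp_le haarAddCircle Y hY f).trans_eq (one_mul _)

theorem exists_partitionSum_le (hc : Summable c) (hW : ∀ j k, ‖entry W j k‖ ≤ c (j - k))
    {ε : ℝ} (hε : 0 < ε) :
    ∃ χ : FinitePartition (haarAddCircle : Measure Circle2Pi),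
      partitionSum W χ ≤ ∫ a, rho (coeffL W a) ∂haarAddCircle + ε := by
  have hcont := continuous_rho_coeffL hc hW
  have hi := integrable_of_continuous hcont
  have hiε : Integrable (fun a : Circle2Pi => rho (coeffL W a) + ε) haarAddCircle :=
    hi.add (integrable_const _)
  have h : ∀ a, ∃ U : Set Circle2Pi, IsOpen U ∧ a ∈ U ∧
      ∀ (Y : Set Circle2Pi) (hY : MeasurableSet Y), Y ⊆ U → ∀ b ∈ Y,
        ‖W ∘L proj haarAddCircle Y hY‖ ^ 2 ≤ rho (coeffL W b) + ε := by
    intro a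
    obtain ⟨U, hUo, haU, hU⟩ := exists_open_norm_comp_proj_sq_le hc hW a (half_pos hε)
    -- Shrinking `U` to where `ρ` has dropped by less than `ε / 2` lets the bound hold with `ρ` at
    -- every point `b` of the cell, ready to be integrated over it.
    refine ⟨U ∩ {b | rho (coeffL W a) < rho (coeffL W b) + ε / 2}, hUo.inter
      (isOpen_lt continuous_const (hcont.add continuous_const)), ⟨haU, ?_⟩,
      fun Y hY hYU b hb => ?_⟩
    · exact lt_add_of_pos_right _ (half_pos hε)
    · have h1 := hU Y hY (hYU.trans Set.inter_subset_left)
      have h2 : rho (coeffL W a) < rho (coeffL W b) + ε / 2 := (hYU hb).2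
      linarith
  choose U hUo haU hU using h
  obtain ⟨t, ht⟩ := CompactSpace.elim_nhds_subcover U fun a => (hUo a).mem_nhds (haU a)
  set V : Fin t.card → Set Circle2Pi := fun j => U (t.equivFin.symm j) with hV
  have hVU : ⋃ j, V j = Set.univ := by
    refine Set.eq_univ_of_forall fun x => ?_
    have hx : x ∈ ⋃ a ∈ t, U a := by
      have : x ∈ (⊤ : Set Circle2Pi) := trivial
      rwa [← ht] at this
    obtain ⟨a, ha, hxa⟩ := Set.mem_iUnion₂.1 hx
    exact Set.mem_iUnion.2 ⟨t.equivFin ⟨a, ha⟩, by simpa [hV] using hxa⟩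
  let χ : FinitePartition (haarAddCircle : Measure Circle2Pi) :=
    { size := t.card
      cell := disjointed V
      measurableSet_cell := fun j =>
        disjointedRec (fun _ _ hs => MeasurableSet.diff hs (hUo _).measurableSet)
          (hUo _).measurableSet
      measure_compl_iUnion := by rw [iUnion_disjointed, hVU, Set.compl_univ, measure_empty]
      measure_inter := fun j k hjk => by
        rw [(disjoint_disjointed V hjk).inter_eq, measure_empty] }
  refine ⟨χ, ?_⟩
  have hle : ∀ j, (haarAddCircle : Measure Circle2Pi).real (χ.cell j) *
      ‖W ∘L proj haarAddCircle (χ.cell j) (χ.measurableSet_cell j)‖ ^ 2 ≤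
      ∫ a in χ.cell j, (rho (coeffL W a) + ε) ∂haarAddCircle := by
    intro j
    rw [← smul_eq_mul, ← setIntegral_const]
    exact setIntegral_mono_on (integrable_const _) hiε.integrableOn
      (χ.measurableSet_cell j) fun b hb =>
        hU _ _ (χ.measurableSet_cell j) (disjointed_subset V j) b hb
  refine (Finset.sum_le_sum fun j _ => hle j).trans_eq ?_
  have hunion : ⋃ j, χ.cell j = Set.univ := by
    change ⋃ j, disjointed V j = _
    rw [iUnion_disjointed, hVU]
  rw [← tsum_fintype (L := .unconditional _), ← integral_iUnion_ae
    (fun j => (χ.measurableSet_cell j).nullMeasurableSet)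
    (fun j k hjk => χ.measure_inter j k hjk) hiε.integrableOn,
    hunion, setIntegral_univ, integral_add hi (integrable_const _)]
  simp

theorem muNorm_sq_eq_integral (hc : Summable c) (hW : ∀ j k, ‖entry W j k‖ ≤ c (j - k)) :
    muNorm W ^ 2 = ∫ a, rho (coeffL W a) ∂haarAddCircle := by
  -- Needed for `le_ciInf`: the real infimum over an empty family would be `0`.
  have hne : Nonempty (FinitePartition (haarAddCircle : Measure Circle2Pi)) :=
    ⟨(exists_partitionSum_le hc hW one_pos).choose⟩
  have h0 : 0 ≤ muNorm W := Real.iInf_nonneg fun χ => Real.sqrt_nonneg _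
  have hI : 0 ≤ ∫ a, rho (coeffL W a) ∂haarAddCircle :=
    integral_nonneg fun a => rho_nonneg (norm_coeffL_le hc hW a)
  refine le_antisymm (le_of_forall_pos_le_add fun ε hε => ?_) ?_
  · obtain ⟨χ, hχ⟩ := exists_partitionSum_le hc hW hε
    have h1 : muNorm W ≤ √(partitionSum W χ) :=
      ciInf_le ⟨0, by rintro _ ⟨χ, rfl⟩; exact Real.sqrt_nonneg _⟩ χ
    have h2 := (Real.le_sqrt h0 (hI.trans (integral_rho_coeffL_le_partitionSum hc hW χ))).1 h1
    exact h2.trans hχ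
  · rw [← Real.sq_sqrt hI]
    exact pow_le_pow_left₀ (Real.sqrt_nonneg _) (le_ciInf fun χ =>
      Real.sqrt_le_sqrt (integral_rho_coeffL_le_partitionSum hc hW χ)) 2

end Main

end MuNorm

theorem mainTheorem1 (W : MuNorm.L2 →L[ℂ] MuNorm.L2) (hW : MuNorm.IsDiagonalType W) :
    Integrable (fun a : MuNorm.Circle2Pi => MuNorm.rho (MuNorm.coeffL W a)) volume ∧
      MuNorm.muNorm W ^ 2 =
        1 / (2 * π) * ∫ a : MuNorm.Circle2Pi, MuNorm.rho (MuNorm.coeffL W a) := by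
  obtain ⟨c, hc, hWc⟩ := hW
  refine ⟨(MuNorm.continuous_rho_coeffL hc hWc).integrable_of_hasCompactSupport
    (HasCompactSupport.of_compactSpace _), ?_⟩
  rw [MuNorm.muNorm_sq_eq_integral hc hWc, integral_haarAddCircle, smul_eq_mul, one_div]
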